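/- Let $(X_n)_{n\ge 0}$ be a time-homogeneous discrete-time Markov chain with finite state space $S$ and (stochastic) transition matrix $P$, and let $M\subset S$ with $M\ne\emptyset$ and $\overline M=S\setminus M\neq\emptyset$. Write $$P=\begin{pmatrix}P_M & P_{M\overline M}\\ P_{\overline M M}& P_{\overline M}\end{pmatrix}$$ for the corresponding block decomposition, and let $e_M$, $e_{\overline M}$ be the all-ones column vectors. For $k\ge1$ let $P(\mathcal R_k=n)$ be the $M\times M$ matrix whose $(i,j)$ entry is the probability, for the chain started in $i\in M$, that at time $n$ the number of returns to $M$ (that is, of times $t\in\{1,\dots,n\}$ with $X_t\in M$) equals $k$ for the first time and $X_n=j$. Put $M_m(\mathcal R_k)=\sum_{n\ge0}n^m P(\mathcal R_k=n)$ for $m\ge0$ (with $0^0=1$), and let $P(\overline{\mathcal R}_k=n)$, $M_m(\overline{\mathcal R}_k)$ be defined in the same way with $\overline M$ in place of $M$. For integers $i,j\ge0$ and real $x$ let $$b_{i,j,x}=\sum_{r=0}^{j}\binom jr(-1)^{j-r}(r+x)^i .$$ The matrix $P$ is called $M$-commutable if $P_{M\overline M}P_{\overline M}^sP_{\overline MM}P_M^r=P_M^rP_{M\overline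 M}P_{\overline M}^sP_{\overline MM}$ for all integers $r,s\ge0$; $\overline M$-commutability is defined by exchanging $M$ and $\overline M$. Let $m\ge0$, $k\ge1$ and $Q=P_{\overline MM}P_{M\overline M}$. In each of the following cases the series defining the moment converges, and the stated formula holds (with $\binom{-1}{0}=1$). a) If $I-P_{\overline M}$ is invertible and $P$ is $M$- and $\overline M$-commutable, then $$M_m(\mathcal R_k)=k^mP_M^k+\sum_{r=1}^k\binom kr P_M^{k-r}P_{M\overline M}Q^{r-1}\left(\sum_{j=0}^m\binom{j+r-1}{j}b_{m,j,k+r}P_{\overline M}^j(I-P_{\overline M})^{-j-r}\right)P_{\overline MM}.$$ b) If $|M|=1$, $P_M=(1-p)$ with $p\ne1$, $I-P_{\overline M}$ is invertible and $P_{\overline M}e_{\overline M}=s_{\overline M}e_{\overline M}$ for a real number $s_{\overline M}$, then $$M_m(\mathcal R_k)=\sum_{r=0}^k\binom kr\left(\frac p{1-p}\right)^r(1-p)^k\sum_{j=0}^m\binom{j+r-1}{j}b_{m,j,k+r}\left(\frac{s_{\overline M}}{1-s_{\overline M}}\right)^j.$$ c) If $|\overline M|=1$, $P_{\overline M}=(0)$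 (so that the visits to the single state of $\overline M$ are the renewals of a discrete phase-type renewal process and $\overline{\mathcal R}_k$ is the time to the $k$-th renewal), $I-P_M$ is invertible and $P_Me_M=s_Me_M$ for a real number $s_M$, then $$M_m(\overline{\mathcal R}_k)=\sum_{j=0}^m\binom{j+k-1}{j}b_{m,j,2k}\left(\frac{s_M}{1-s_M}\right)^j.$$ -/

import Mathlib

noncomputable section

/-- The moment generating Stirling numbers `b_{i,j,k}` (with `0 ^ 0 = 1`). -/
def msn (i j : ℕ) (k : ℝ) : ℝ :=
  ∑ r ∈ Finset.range (j + 1), (j.choose r : ℝ) * (-1) ^ (j - r) * ((r : ℝ) + k) ^ i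

/-- The block `P_{AB} = (p_{ij})` with `i ∈ A`, `j ∈ B`. -/
def block {S : Type*} (P : Matrix S S ℝ) (A B : Finset S) : Matrix A B ℝ :=
  P.submatrix (fun a : A => (a : S)) (fun b : B => (b : S))

/-- `A`-commutability of `P`, where `B` stands for the complement of `A`:
`P_{AB} P_B^s P_{BA}` commutes with `P_A^r` for all `r, s ≥ 0`. -/
def IsCommutable {S : Type*} [DecidableEq S] (P : Matrix S S ℝ) (A B : Finset S) : Prop :=
  ∀ r s : ℕ,
    block P A B * block P B B ^ s * block P B A * block P A A ^ r =
      block P A A ^ r * (block P A B * block P B B ^ s * block P B A)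

/-- `X` is a time-homogeneous discrete time Markov chain with finite (discrete) state space `S`
and transition matrix `P`; `μ i` is the probability measure under which it starts in `i`.
The last field is the Markov property
`Pr(X_{n+1} = x_{n+1} | X_0 = x_0, …, X_n = x_n) = P(x_n, x_{n+1})`, multiplied by the
probability of the conditioning event. -/
structure IsMarkovChain {S Ω : Type*} [MeasurableSpace Ω] (P : Matrix S S ℝ)
    (X : ℕ → Ω → S) (μ : S → MeasureTheory.Measure Ω) : Prop where
  measurableSet_eq : ∀ (n : ℕ) (x : S), MeasurableSet {ω | X n ω = x}
  isProbabilityMeasure : ∀ i, MeasureTheory.IsProbabilityMeasure (μ i)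
  start : ∀ i, μ i {ω | X 0 ω = i} = 1
  markov : ∀ (i : S) (n : ℕ) (x : ℕ → S),
    (μ i).real {ω | ∀ t ≤ n + 1, X t ω = x t} =
      (μ i).real {ω | ∀ t ≤ n, X t ω = x t} * P (x n) (x (n + 1))

/-- The number of visits in `A` at the times `1, …, n` (for a chain that starts in `A`: the number
of returns to `A` up to time `n`). -/
def numVisits {S Ω : Type*} [DecidableEq S] (X : ℕ → Ω → S) (A : Finset S) (n : ℕ) (ω : Ω) : ℕ :=
  ((Finset.Icc 1 n).filter fun t => X t ω ∈ A).card

/-- The first time at which the number of visits in `A` is `k` (`⊤` if there is none). -/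
def visitTime {S Ω : Type*} [DecidableEq S] (X : ℕ → Ω → S) (A : Finset S) (k : ℕ) (ω : Ω) : ℕ∞ :=
  ⨅ (n : ℕ) (_ : numVisits X A n ω = k), (n : ℕ∞)

/-- The matrix `Pr(R_k = n)` of the `k`-th recurrence time of `A`: its entry at `i, j ∈ A` is the
probability, starting in `i`, that the `k`-th return to `A` happens at time `n` and in state `j`. -/
def recurrenceProb {S Ω : Type*} [DecidableEq S] [MeasurableSpace Ω] (X : ℕ → Ω → S)
    (μ : S → MeasureTheory.Measure Ω) (A : Finset S) (k n : ℕ) : Matrix A A ℝ :=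
  Matrix.of fun i j => (μ i).real {ω | visitTime X A k ω = (n : ℕ∞) ∧ X n ω = j}

/-- The matrix `M_m(R_k) = ∑_{n ≥ 0} n^m Pr(R_k = n)` of `m`-th moments of the `k`-th recurrence
time of `A` (with `0 ^ 0 = 1`). -/
def recurrenceMoment {S Ω : Type*} [DecidableEq S] [MeasurableSpace Ω] (X : ℕ → Ω → S)
    (μ : S → MeasureTheory.Measure Ω) (A : Finset S) (m k : ℕ) : Matrix A A ℝ :=
  ∑' n : ℕ, (n : ℝ) ^ m • recurrenceProb X μ A k n

/-- Convergence of the series that defines `M_m(R_k)`. -/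
def HasRecurrenceMoment {S Ω : Type*} [DecidableEq S] [MeasurableSpace Ω] (X : ℕ → Ω → S)
    (μ : S → MeasureTheory.Measure Ω) (A : Finset S) (m k : ℕ) : Prop :=
  Summable fun n : ℕ => (n : ℝ) ^ m • recurrenceProb X μ A k n

end

/-!
Let `A` be a set of states with complement `B`, and let `F(z)` be the matrix generating function of
the first recurrence time of `A`. A first return takes either one step inside `A` or an excursion
of `s + 2` steps through `B`, so that
`F(z) = z P_A + z² ∑ₛ zˢ P_{AB} P_Bˢ P_{BA}` (`recurrenceSeries`).

The probabilistic input is that the `k`-th recurrence time has generating function `F(z)^k`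
(`recurrenceProb_eq_coeff`). For `j ∈ A`, the `k`-th visit happens at time `n` in `j` exactly when
there have been `k` visits up to time `n` and `X_n = j`; hence it suffices to follow the joint law
of the number of visits and the position (`visitLaw`), which satisfies a one-step recursion by the
Markov property (`numVisits_and_succ`). Solving the recursion on `B` expresses the law there
through the last time spent in `A` (`visitLaw_succ_eq_sum_antidiagonal`).

Under the commutation hypotheses `F(z)^k` expands by the binomial theorem, and with
`Q = P_{BA} P_{AB}` the powers of the second summand collapse to
`P_{AB} Q^{r-1} (1 - z P_B)^{-r} P_{BA}` (`mk_mul_pow_mul_pow`), a negative binomial series in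
`P_B`. The weights `(s + k + r)^m` are expanded in binomial coefficients by Newton's formula
(`add_pow_eq_sum_choose_mul_msn`), whose coefficients are the numbers `msn`, and each resulting
series is again negative binomial (`hasSum_choose_mul_choose_smul_pow`). Everything converges as
soon as `1 - P_B` is invertible, because the partial sums of the nonnegative series `∑ P_Bⁿ` are
then bounded (`summable_block_pow`).

If `A` is a single state and the rows of `P_B` have equal sums `s`, the coefficients of `F` are
the scalars `(1 - a)(1 - s) sˡ`, although `Q` need not commute with `P_B`; the same expansion then
applies with `P_{AB}`, `P_B`, `P_{BA}` replaced by scalars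
(`hasSum_recurrenceProb_of_card_eq_one`). The renewal formula is the case `a = 0`, in which only
the term `r = k` survives.
-/

/-! ### Newton's formula and negative binomial series -/

section Binomial

open Finset

/-- Newton's forward difference formula for `y ^ m` at `x`: the numbers `msn m j x` are the iterated
differences, which vanish for `j > m`. -/
theorem add_pow_eq_sum_choose_mul_msn (m s : ℕ) (x : ℝ) :
    ((s : ℝ) + x) ^ m = ∑ j ∈ range (m + 1), (s.choose j : ℝ) * msn m j x := by
  have hΔ : ∀ j, (fwdDiff (1 : ℝ))^[j] (fun y : ℝ => y ^ m) x = msn m j x := by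
    intro j
    rw [fwdDiff_iter_eq_sum_shift, msn]
    refine sum_congr rfl fun r _ => ?_
    simp only [nsmul_eq_mul, mul_one, zsmul_eq_mul, Int.cast_mul, Int.cast_pow, Int.cast_neg,
      Int.cast_one, Int.cast_natCast]
    ring
  have h := shift_eq_sum_fwdDiff_iter (1 : ℝ) (fun y : ℝ => y ^ m) s x
  simp only [hΔ, nsmul_eq_mul, mul_one] at h
  rw [add_comm, h]
  have hzero : ∀ j, m < j → msn m j x = 0 := fun j hj => by
    rw [← hΔ, fwdDiff_iter_pow_eq_zero_of_lt hj]; rfl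
  have h1 : ∀ N, m ≤ N → s ≤ N → ∑ j ∈ range (s + 1), (s.choose j : ℝ) * msn m j x =
      ∑ j ∈ range (N + 1), (s.choose j : ℝ) * msn m j x := fun N _ hs =>
    sum_subset (range_subset_range.2 (by omega)) fun j _ hj => by
      rw [Nat.choose_eq_zero_of_lt (by simpa using hj)]; simp
  rw [h1 (max m s) (le_max_left _ _) (le_max_right _ _)]
  refine (sum_subset (range_subset_range.2 (by omega)) fun j _ hj => ?_).symm
  rw [hzero j (by simpa using hj), mul_zero]

theorem sum_antidiagonal_choose_snd (r n : ℕ) :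
    ∑ x ∈ antidiagonal n, (x.2 + r).choose x.2 = (n + r + 1).choose n := by
  rw [Nat.sum_antidiagonal_eq_sum_range_succ_mk, ← sum_range_reflect]
  have : ∀ i ∈ range (n + 1), (n - (n + 1 - 1 - i) + r).choose (n - (n + 1 - 1 - i)) =
      (i + r).choose r := fun i hi => by
    have : n - (n + 1 - 1 - i) = i := by simp at hi; omega
    rw [this, Nat.choose_symm_add]
  rw [sum_congr rfl this, Nat.sum_range_add_choose, ← Nat.choose_symm_of_eq_add]
  omega

end Binomial

section Series

open Finset

variable {R : Type*} [NormedRing R] [CompleteSpace R] [NormedAlgebra ℝ R] {d e : R}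

/-- The negative binomial series `∑ₙ C(n+r, n) dⁿ = (1 - d)^{-(r+1)}`. -/
theorem hasSum_choose_smul_pow (hd : Summable fun n => ‖d ^ n‖) (he : HasSum (fun n => d ^ n) e)
    (r : ℕ) :
    Summable (fun n : ℕ => ‖((n + r).choose n : ℝ) • d ^ n‖) ∧
      HasSum (fun n : ℕ => ((n + r).choose n : ℝ) • d ^ n) (e ^ (r + 1)) := by
  induction r with
  | zero => simpa using ⟨hd, he⟩
  | succ r ih =>
    have key : ∀ n, ∑ x ∈ antidiagonal n, d ^ x.1 * (((x.2 + r).choose x.2 : ℝ) • d ^ x.2) =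
        ((n + (r + 1)).choose n : ℝ) • d ^ n := fun n => by
      rw [← add_assoc, ← sum_antidiagonal_choose_snd, Nat.cast_sum, sum_smul]
      refine sum_congr rfl fun x hx => ?_
      rw [mul_smul_comm, ← pow_add, mem_antidiagonal.1 hx]
    have h1 := summable_norm_sum_mul_antidiagonal_of_summable_norm hd ih.1
    have h2 := tsum_mul_tsum_eq_tsum_sum_antidiagonal_of_summable_norm hd ih.1
    simp only [key] at h1 h2
    refine ⟨h1, ?_⟩
    rw [he.tsum_eq, ih.2.tsum_eq] at h2
    rw [pow_succ', h2]
    exact h1.of_norm.hasSum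

theorem choose_mul_choose_add (s j r : ℕ) :
    (s + j).choose j * (s + j + r).choose (s + j) =
      (j + r).choose j * (s + (j + r)).choose s := by
  have h1 := Nat.add_choose_mul_factorial_mul_factorial s j
  have h2 := Nat.add_choose_mul_factorial_mul_factorial (s + j) r
  have h3 := Nat.add_choose_mul_factorial_mul_factorial j r
  have h4 := Nat.add_choose_mul_factorial_mul_factorial s (j + r)
  rw [Nat.choose_symm_add (a := s + j), Nat.choose_symm_add (a := s), Nat.choose_symm_add (a := j)]
  have hp : 0 < s.factorial * j.factorial * r.factorial := by positivity
  refine Nat.eq_of_mul_eq_mul_right hp ?_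
  rw [← add_assoc] at h4 ⊢
  calc _ = (s + j + r).choose r * ((s + j).choose j * s.factorial * j.factorial) *
        r.factorial := by ring
    _ = (s + j + r).choose (j + r) * s.factorial *
        ((j + r).choose r * j.factorial * r.factorial) := by rw [h1, h2, h3, h4]
    _ = _ := by ring

/-- The binomial moments of the negative binomial series: by the trinomial identity
`C(s+j, j) C(s+j+r, s+j) = C(j+r, j) C(s+j+r, s)` they are shifted negative binomial series. -/
theorem hasSum_choose_mul_choose_smul_pow (hd : Summable fun n => ‖d ^ n‖)
    (he : HasSum (fun n => d ^ n) e) (j r : ℕ) :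
    HasSum (fun s : ℕ => ((s.choose j : ℝ) * ((s + r).choose s : ℝ)) • d ^ s)
      (((j + r).choose j : ℝ) • (d ^ j * e ^ (j + r + 1))) := by
  have h := (((hasSum_choose_smul_pow hd he (j + r)).2.mul_left (d ^ j)).const_smul
    ((j + r).choose j : ℝ))
  refine ((add_left_injective j).hasSum_iff fun s hs => ?_).1 (h.congr_fun fun s => ?_)
  · rw [Nat.choose_eq_zero_of_lt]
    · simp
    · by_contra hj
      exact hs ⟨s - j, by simp; omega⟩
  · simp only [Function.comp]
    rw [mul_smul_comm, ← pow_add, smul_smul, add_comm j s]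
    congr 1
    exact_mod_cast (choose_mul_choose_add s j r)

/-- Polynomially weighted negative binomial series: expand `(s + x)^m` in binomial coefficients
`C(s, j)` and sum each term. -/
theorem hasSum_add_pow_mul_choose_smul_pow (hd : Summable fun n => ‖d ^ n‖)
    (he : HasSum (fun n => d ^ n) e) (m r : ℕ) (x : ℝ) :
    HasSum (fun s : ℕ => (((s : ℝ) + x) ^ m * ((s + r).choose s : ℝ)) • d ^ s)
      (∑ j ∈ range (m + 1),
        (((j + r).choose j : ℝ) * msn m j x) • (d ^ j * e ^ (j + r + 1))) := by
  have h := hasSum_sum (s := range (m + 1)) fun j _ =>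
    (hasSum_choose_mul_choose_smul_pow hd he j r).const_smul (msn m j x)
  convert h using 1
  · ext s
    simp only [smul_smul]
    rw [← sum_smul, add_pow_eq_sum_choose_mul_msn, sum_mul]
    congr 1
    exact sum_congr rfl fun j _ => by ring
  · exact sum_congr rfl fun j _ => by rw [smul_smul, mul_comm]

end Series

section MatrixSeries

open Finset

/-- The polynomially weighted negative binomial series of a square matrix: the Neumann series
converges absolutely for a complete algebra norm that induces the entrywise topology. -/
theorem Matrix.hasSum_add_pow_mul_choose_smul_pow {n : Type*} [Fintype n] [DecidableEq n]
    {D E : Matrix n n ℝ} (h : HasSum (fun k => D ^ k) E) (m r : ℕ) (x : ℝ) :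
    HasSum (fun s : ℕ => (((s : ℝ) + x) ^ m * ((s + r).choose s : ℝ)) • D ^ s)
      (∑ j ∈ range (m + 1), (((j + r).choose j : ℝ) * msn m j x) •
        (D ^ j * E ^ (j + r + 1))) := by
  let _ : NormedRing (Matrix n n ℝ) := Matrix.linftyOpNormedRing
  let _ : NormedAlgebra ℝ (Matrix n n ℝ) := Matrix.linftyOpNormedAlgebra
  have : CompleteSpace (Matrix n n ℝ) := FiniteDimensional.complete ℝ _
  have h' : Summable fun k => ‖D ^ k‖ := h.summable.norm
  exact _root_.hasSum_add_pow_mul_choose_smul_pow h' h m r x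

end MatrixSeries

/-! ### Powers of generating functions over a matrix ring -/

section GeneratingFunction

open Finset PowerSeries

variable {R : Type*} [Ring R] [Algebra ℝ R]

/-- The binomial expansion of `(aX + X² w)^k`; the `r`-th term is shifted by `X^(k + r)`. -/
theorem coeff_linear_add_sq_mul_pow (a : R) (w : ℕ → R) (h : ∀ s, Commute a (w s)) (k n : ℕ) :
    coeff n ((C a * X + X ^ 2 * PowerSeries.mk w : R⟦X⟧) ^ k) =
      ∑ r ∈ range (k + 1), (k.choose r : ℝ) • (a ^ (k - r) *
        if k + r ≤ n then coeff (n - (k + r)) (PowerSeries.mk w ^ r) else 0) := by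
  have hw : Commute (C a : R⟦X⟧) (PowerSeries.mk w) := by
    ext n
    rw [coeff_C_mul, coeff_mul_C, coeff_mk, (h n).eq]
  have hX : ∀ φ : R⟦X⟧, Commute (X : R⟦X⟧) φ := fun φ => (commute_X φ).symm
  have hcomm : Commute (X ^ 2 * PowerSeries.mk w) (C a * X : R⟦X⟧) :=
    (((hX _).pow_left 2)).mul_left (hw.symm.mul_right (hX _).symm)
  rw [add_comm, hcomm.add_pow, map_sum]
  refine sum_congr rfl fun r hr => ?_
  have hr' : r ≤ k := by simpa [Nat.lt_succ_iff] using hr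
  have e1 : (X ^ 2 * PowerSeries.mk w : R⟦X⟧) ^ r * (C a * X) ^ (k - r) =
      C (a ^ (k - r)) * (X ^ (k + r) * PowerSeries.mk w ^ r) := by
    rw [((hX (PowerSeries.mk w)).pow_left 2).mul_pow, (hX (C a)).symm.mul_pow, ← pow_mul]
    have hkr : k + r = 2 * r + (k - r) := by omega
    rw [hkr, pow_add, map_pow]
    have c1 : Commute (PowerSeries.mk w ^ r) ((C a : R⟦X⟧) ^ (k - r)) := (hw.symm.pow_pow _ _)
    have c2 : Commute ((X : R⟦X⟧) ^ (2 * r)) ((C a : R⟦X⟧) ^ (k - r)) := (hX _).pow_pow _ _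
    have c3 : Commute (PowerSeries.mk w ^ r) ((X : R⟦X⟧) ^ (k - r)) := ((hX _).symm.pow_pow _ _)
    calc _ = X ^ (2 * r) * (PowerSeries.mk w ^ r * C a ^ (k - r)) * X ^ (k - r) := by noncomm_ring
      _ = (X ^ (2 * r) * C a ^ (k - r)) * (PowerSeries.mk w ^ r * X ^ (k - r)) := by
        rw [c1.eq]; noncomm_ring
      _ = _ := by rw [c2.eq, c3.eq]; noncomm_ring
  have e2 : ∀ φ : R⟦X⟧, φ * ((k.choose r : ℕ) : R⟦X⟧) = (k.choose r) • φ := fun φ => by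
    rw [nsmul_eq_mul, (Nat.cast_commute _ _).eq]
  rw [e1, e2, map_nsmul, coeff_C_mul, coeff_X_pow_mul', Nat.cast_smul_eq_nsmul]

theorem hasSum_add_pow_smul_coeff_one [TopologicalSpace R] (m : ℕ) (x : ℝ) :
    HasSum (fun s : ℕ => ((s : ℝ) + x) ^ m • coeff s (1 : R⟦X⟧)) (x ^ m • 1) := by
  convert hasSum_single (f := fun s : ℕ => ((s : ℝ) + x) ^ m • coeff s (1 : R⟦X⟧)) 0 ?_ using 1
  · simp
  · intro s hs
    simp [coeff_one, hs]

variable [TopologicalSpace R] [IsTopologicalRing R]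

/-- If `a` commutes with all `w s`, the `m`-th moment of the coefficients of `(aX + X² w)^k` is
obtained from the shifted `m`-th moments of the powers of `w` by the binomial theorem. -/
theorem hasSum_pow_smul_coeff_linear_add_sq_mul_pow (a : R) (w : ℕ → R)
    (h : ∀ s, Commute a (w s)) (m k : ℕ) (T : ℕ → R)
    (hT : ∀ r ≤ k, HasSum (fun s : ℕ => ((s : ℝ) + (k + r)) ^ m •
      coeff s (PowerSeries.mk w ^ r)) (T r)) :
    HasSum (fun n : ℕ => (n : ℝ) ^ m • coeff n ((C a * X + X ^ 2 * PowerSeries.mk w : R⟦X⟧) ^ k))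
      (∑ r ∈ range (k + 1), (k.choose r : ℝ) • (a ^ (k - r) * T r)) := by
  simp only [coeff_linear_add_sq_mul_pow a w h, smul_sum]
  refine hasSum_sum fun r hr => ?_
  have hr' : r ≤ k := by simpa [Nat.lt_succ_iff] using hr
  have h1 : HasSum (fun n : ℕ => (n : ℝ) ^ m •
      if k + r ≤ n then coeff (n - (k + r)) (PowerSeries.mk w ^ r) else 0) (T r) := by
    refine ((add_left_injective (k + r)).hasSum_iff fun s hs => ?_).1
      ((hT r hr').congr_fun fun s => ?_)
    · rw [if_neg, smul_zero]
      intro hj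
      exact hs ⟨s - (k + r), by simp; omega⟩
    · simp
  refine ((h1.mul_left (a ^ (k - r))).const_smul (k.choose r : ℝ)).congr_fun fun n => ?_
  rw [mul_smul_comm, smul_comm]

end GeneratingFunction

section Commutation

open Finset PowerSeries

variable {m n : Type*} [Fintype m] [Fintype n] [DecidableEq m] [DecidableEq n]

/-- If `C B` commutes with `D`, then `(∑ₛ zˢ B Dˢ C)^(r+1) = B (C B)^r (1 - z D)^{-(r+1)} C`. -/
theorem mk_mul_pow_mul_pow (B : Matrix m n ℝ) (D : Matrix n n ℝ) (Cm : Matrix n m ℝ)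
    (h : Commute (Cm * B) D) (r : ℕ) :
    (PowerSeries.mk fun s => B * D ^ s * Cm) ^ (r + 1) =
      PowerSeries.mk fun s => ((s + r).choose s : ℝ) • (B * (Cm * B) ^ r * D ^ s * Cm) := by
  induction r with
  | zero => simp
  | succ r ih =>
    rw [pow_succ', ih]
    ext1 s
    rw [coeff_mul, coeff_mk, ← add_assoc, ← sum_antidiagonal_choose_snd, Nat.cast_sum, sum_smul]
    refine sum_congr rfl fun x hx => ?_
    rw [coeff_mk, coeff_mk, mul_smul_comm]
    congr 1
    have e1 : D ^ x.1 * (Cm * B) ^ (r + 1) = (Cm * B) ^ (r + 1) * D ^ x.1 :=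
      (h.symm.pow_pow _ _).eq
    calc B * D ^ x.1 * Cm * (B * (Cm * B) ^ r * D ^ x.2 * Cm)
        = B * (D ^ x.1 * (Cm * B) ^ (r + 1)) * D ^ x.2 * Cm := by
          rw [pow_succ']; simp only [Matrix.mul_assoc]
      _ = B * (Cm * B) ^ (r + 1) * (D ^ x.1 * D ^ x.2) * Cm := by
          rw [e1]; simp only [Matrix.mul_assoc]
      _ = _ := by rw [← pow_add, mem_antidiagonal.1 hx]

end Commutation

/-! ### Blocks of a stochastic matrix -/

section Stochastic

open Finset

variable {S : Type*} [Fintype S] [DecidableEq S] {P : Matrix S S ℝ}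

theorem block_pow_nonneg (hP : P ∈ Matrix.rowStochastic ℝ S) (A : Finset S) (n : ℕ) (i j : A) :
    0 ≤ (block P A A ^ n) i j := by
  induction n generalizing j with
  | zero =>
    rw [pow_zero, Matrix.one_apply]
    split_ifs <;> simp
  | succ n ih =>
    rw [pow_succ, Matrix.mul_apply]
    exact sum_nonneg fun l _ => mul_nonneg (ih l) (Matrix.nonneg_of_mem_rowStochastic hP)

/-- Powers of a block are dominated by the powers of the whole stochastic matrix. -/
theorem block_pow_le_one (hP : P ∈ Matrix.rowStochastic ℝ S) (A : Finset S) (n : ℕ) (i j : A) :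
    (block P A A ^ n) i j ≤ 1 := by
  have h : ∀ j : A, (block P A A ^ n) i j ≤ (P ^ n) i j := by
    induction n with
    | zero =>
      intro j
      rw [pow_zero, pow_zero, Matrix.one_apply, Matrix.one_apply]
      simp only [Subtype.ext_iff, le_refl]
    | succ n ih =>
      intro j
      rw [pow_succ, pow_succ, Matrix.mul_apply, Matrix.mul_apply]
      have hPn := pow_mem hP n
      calc _ ≤ ∑ l : A, (P ^ n) i l * P l j := sum_le_sum fun l _ =>
            mul_le_mul_of_nonneg_right (ih l) (Matrix.nonneg_of_mem_rowStochastic hP)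
        _ = ∑ l ∈ A, (P ^ n) i l * P l j := sum_coe_sort A fun l => (P ^ n) i l * P l j
        _ ≤ _ := sum_le_univ_sum_of_nonneg fun l =>
            mul_nonneg (Matrix.nonneg_of_mem_rowStochastic hPn)
              (Matrix.nonneg_of_mem_rowStochastic hP)
  exact (h j).trans (Matrix.le_one_of_mem_rowStochastic (pow_mem hP n))

/-- The Neumann series of a block `D` converges as soon as `1 - D` is invertible: its partial sums
`(1 - Dⁿ)(1 - D)⁻¹` are bounded and its terms nonnegative. -/
theorem summable_block_pow (hP : P ∈ Matrix.rowStochastic ℝ S) (A : Finset S)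
    (hA : IsUnit (1 - block P A A)) : Summable fun n => block P A A ^ n := by
  have hdet := (Matrix.isUnit_iff_isUnit_det _).1 hA
  refine Pi.summable.2 fun i => Pi.summable.2 fun j => ?_
  -- The entries of `1 - Dⁿ` lie in `[-1, 1]`; the bound `2` on their absolute values suffices.
  refine summable_of_sum_range_le (c := ∑ l, 2 * |(1 - block P A A)⁻¹ l j|)
    (fun n => block_pow_nonneg hP A n i j) fun n => ?_
  have h : ∑ s ∈ range n, block P A A ^ s = (1 - block P A A ^ n) * (1 - block P A A)⁻¹ := by
    rw [← geom_sum_mul_neg, mul_assoc, Matrix.mul_nonsing_inv _ hdet, mul_one]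
  have h' := congrFun (congrFun h i) j
  rw [Matrix.sum_apply, Matrix.mul_apply] at h'
  rw [h']
  refine sum_le_sum fun l _ => (le_abs_self _).trans ?_
  rw [abs_mul]
  refine mul_le_mul_of_nonneg_right ?_ (abs_nonneg _)
  rw [Matrix.sub_apply, abs_le]
  have h0 := block_pow_nonneg hP A n i l
  have h1 := block_pow_le_one hP A n i l
  rw [Matrix.one_apply]
  split_ifs <;> constructor <;> linarith

theorem hasSum_block_pow (hP : P ∈ Matrix.rowStochastic ℝ S) (A : Finset S)
    (hA : IsUnit (1 - block P A A)) :
    HasSum (fun n => block P A A ^ n) (1 - block P A A)⁻¹ := by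
  have h := summable_block_pow hP A hA
  rw [Matrix.inv_eq_right_inv h.one_sub_mul_tsum_pow]
  exact h.hasSum

/-- Splitting a sum over `S` into the sums over a set and its complement. -/
theorem sum_eq_sum_coe_add_sum_coe {A B : Finset S} (hB : B = Aᶜ) (f : S → ℝ) :
    ∑ y, f y = ∑ y : A, f y + ∑ y : B, f y := by
  subst hB
  rw [sum_coe_sort A f, sum_coe_sort Aᶜ f, sum_add_sum_compl]

end Stochastic

/-! ### Visits and visit times -/

section Visits

open Finset

variable {S Ω : Type*} [DecidableEq S] {X : ℕ → Ω → S}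

theorem numVisits_succ (A : Finset S) (n : ℕ) (ω : Ω) :
    numVisits X A (n + 1) ω = numVisits X A n ω + if X (n + 1) ω ∈ A then 1 else 0 := by
  rw [numVisits, numVisits, card_filter, card_filter, sum_Icc_succ_top (by omega)]

theorem numVisits_zero (A : Finset S) (ω : Ω) : numVisits X A 0 ω = 0 := by
  simp [numVisits]

theorem numVisits_mono (A : Finset S) (ω : Ω) : Monotone fun n => numVisits X A n ω :=
  monotone_nat_of_le_succ fun n => by rw [numVisits_succ]; omega

theorem visitTime_eq_iff (A : Finset S) (k n : ℕ) (ω : Ω) :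
    visitTime X A k ω = (n : ℕ∞) ↔
      numVisits X A n ω = k ∧ ∀ l < n, numVisits X A l ω ≠ k := by
  classical
  by_cases h : ∃ l, numVisits X A l ω = k
  · have hv : visitTime X A k ω = (Nat.find h : ℕ∞) :=
      le_antisymm (iInf₂_le (Nat.find h) (Nat.find_spec h))
        (le_iInf₂ fun l hl => by exact_mod_cast Nat.find_min' h hl)
    rw [hv, Nat.cast_inj, Nat.find_eq_iff]
  · push Not at h
    have hv : visitTime X A k ω = ⊤ := by simp [visitTime, h]
    rw [hv]
    simp [h]

/-- For `j ∈ A`, the `k`-th visit in `A` takes place at time `n` and in `j` if and only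
if there have been `k` visits up to time `n` and the chain is in `j` at time `n`. -/
theorem visitTime_eq_and_iff {A : Finset S} (k n : ℕ) (ω : Ω) {j : S}
    (hj : j ∈ A) :
    visitTime X A k ω = (n : ℕ∞) ∧ X n ω = j ↔ numVisits X A n ω = k ∧ X n ω = j := by
  rw [visitTime_eq_iff]
  refine ⟨fun h => ⟨h.1.1, h.2⟩, fun h => ⟨⟨h.1, fun l hl => ?_⟩, h.2⟩⟩
  -- The visit at time `n` itself is counted, so that every earlier count is smaller.
  obtain ⟨n, rfl⟩ : ∃ n', n = n' + 1 := ⟨n - 1, by omega⟩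
  have h1 := numVisits_mono (X := X) A ω (Nat.lt_succ_iff.1 hl)
  have h2 := numVisits_succ (X := X) A n ω
  rw [h.2, if_pos hj] at h2
  have h3 := h.1
  simp only at h1
  omega

end Visits

/-! ### The law of the recurrence times -/

section Markov

open Finset PowerSeries MeasureTheory

variable {S Ω : Type*} [MeasurableSpace Ω] {P : Matrix S S ℝ} {X : ℕ → Ω → S} {μ : S → Measure Ω}

/-- The path that follows `w` up to time `n` and stays at its last value. -/
def extendPath (n : ℕ) (w : Fin (n + 1) → S) (t : ℕ) : S :=
  w ⟨min t n, Nat.lt_succ_of_le (min_le_right t n)⟩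

theorem measurableSet_path (hX : IsMarkovChain P X μ) (n : ℕ) (x : ℕ → S) :
    MeasurableSet {ω | ∀ t ≤ n, X t ω = x t} := by
  have : {ω | ∀ t ≤ n, X t ω = x t} = ⋂ t, ⋂ (_ : t ≤ n), {ω | X t ω = x t} := by
    ext; simp
  rw [this]
  exact MeasurableSet.iInter fun t => MeasurableSet.iInter fun _ => hX.measurableSet_eq t _

section

variable [DecidableEq S]

/-- The joint law of the number of visits in `A` up to time `n` and the position at time `n`, for
the chain started in `i`. -/
noncomputable def visitLaw (X : ℕ → Ω → S) (μ : S → Measure Ω) (A : Finset S) (i : S)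
    (c n : ℕ) (y : S) : ℝ :=
  (μ i).real {ω | numVisits X A n ω = c ∧ X n ω = y}

theorem recurrenceProb_apply (A : Finset S) (k n : ℕ) (i j : A) :
    recurrenceProb X μ A k n i j = visitLaw X μ A i k n j := by
  simp only [recurrenceProb, Matrix.of_apply, visitLaw, visitTime_eq_and_iff k n _ j.2]

theorem visitLaw_zero_succ_of_mem (A : Finset S) (i : S) (n : ℕ) {y : S} (hy : y ∈ A) :
    visitLaw X μ A i 0 (n + 1) y = 0 := by
  have : {ω | numVisits X A (n + 1) ω = 0 ∧ X (n + 1) ω = y} = ∅ := by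
    ext ω
    simp only [Set.mem_ofPred_eq, Set.mem_empty_iff_false, iff_false, not_and]
    intro h1 h2
    rw [numVisits_succ, h2, if_pos hy] at h1
    omega
  rw [visitLaw, this, measureReal_empty]

theorem visitLaw_zero (hX : IsMarkovChain P X μ) (A : Finset S) (i : S) (c : ℕ) (y : S) :
    visitLaw X μ A i c 0 y = if c = 0 ∧ i = y then 1 else 0 := by
  have := hX.isProbabilityMeasure i
  rw [visitLaw]
  simp only [numVisits_zero]
  have h1 : (μ i).real {ω | X 0 ω = i} = 1 := by rw [measureReal_def, hX.start, ENNReal.toReal_one]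
  split_ifs with h
  · obtain ⟨rfl, rfl⟩ := h
    simpa using h1
  · rw [measureReal_eq_zero_iff]
    refine measure_mono_null (t := {ω | X 0 ω = i}ᶜ) (fun ω hω hi => h ?_) ?_
    · exact ⟨hω.1.symm, hi.symm.trans hω.2⟩
    · rw [prob_compl_eq_zero_iff (hX.measurableSet_eq 0 i)]
      exact hX.start i

end

variable [Fintype S]

open scoped Classical in
/-- The mass of an event that depends on the path up to time `n` only is the sum of the masses of
the finitely many path cylinders it consists of. -/
theorem real_pathEvent_eq_sum (hX : IsMarkovChain P X μ) (ν : Measure Ω) [IsFiniteMeasure ν]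
    (n : ℕ) (Q : (ℕ → S) → Prop) (hQ : ∀ u v : ℕ → S, (∀ t ≤ n, u t = v t) → Q u → Q v) :
    ν.real {ω | Q fun t => X t ω} =
      ∑ w : Fin (n + 1) → S with Q (extendPath n w),
        ν.real {ω | ∀ t ≤ n, X t ω = extendPath n w t} := by
  let f : Ω → (Fin (n + 1) → S) := fun ω t => X t ω
  have hf : ∀ w, f ⁻¹' {w} = {ω | ∀ t ≤ n, X t ω = extendPath n w t} := fun w => by
    ext ω
    simp only [Set.mem_preimage, Set.mem_singleton_iff, Set.mem_ofPred_eq, funext_iff, f]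
    constructor
    · intro h t ht
      have := h ⟨min t n, Nat.lt_succ_of_le (min_le_right t n)⟩
      simpa [extendPath, min_eq_left ht] using this
    · intro h t
      have ht : (t : ℕ) ≤ n := Nat.lt_succ_iff.1 t.2
      have := h t ht
      simpa [extendPath, min_eq_left ht] using this
  have hext : ∀ ω, ∀ t ≤ n, X t ω = extendPath n (f ω) t := fun ω t ht => by
    simp [extendPath, f, min_eq_left ht]
  simp only [← hf]
  rw [sum_measureReal_preimage_singleton _ fun w _ => by
    rw [hf]; exact measurableSet_path hX n _]
  congr 1
  ext ω
  simp only [Set.mem_ofPred_eq, Set.mem_preimage, coe_filter, mem_univ, true_and]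
  exact ⟨hQ _ _ (hext ω), hQ _ _ fun t ht => (hext ω t ht).symm⟩

/-- The Markov property for events that depend on the path up to time `n`. -/
theorem real_pathEvent_and_succ (hX : IsMarkovChain P X μ) (i : S) (n : ℕ) (Q : (ℕ → S) → Prop)
    (hQ : ∀ u v : ℕ → S, (∀ t ≤ n, u t = v t) → Q u → Q v) (y : S) :
    (μ i).real {ω | Q (fun t => X t ω) ∧ X (n + 1) ω = y} =
      ∑ x, (μ i).real {ω | Q (fun t => X t ω) ∧ X n ω = x} * P x y := by
  classical
  have := hX.isProbabilityMeasure i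
  have hsucc := hX.measurableSet_eq (n + 1) y
  have hQx : ∀ x, (μ i).real {ω | Q (fun t => X t ω) ∧ X n ω = x} * P x y =
      ∑ w : Fin (n + 1) → S with Q (extendPath n w), if extendPath n w n = x then
        (μ i).real {ω | ∀ t ≤ n, X t ω = extendPath n w t} * P (extendPath n w n) y else 0 := by
    intro x
    rw [real_pathEvent_eq_sum hX (μ i) n (fun u => Q u ∧ u n = x)
      (fun u v h hu => ⟨hQ u v h hu.1, (h n le_rfl) ▸ hu.2⟩), sum_mul, ← sum_filter, filter_filter]
    refine sum_congr (by congr) fun w hw => ?_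
    rw [(mem_filter.1 hw).2.2]
  simp only [hQx]
  rw [sum_comm]
  simp only [sum_ite_eq, mem_univ, if_true]
  have hpath := real_pathEvent_eq_sum hX ((μ i).restrict {ω | X (n + 1) ω = y}) n Q hQ
  have hset : (μ i).real {ω | Q (fun t => X t ω) ∧ X (n + 1) ω = y} =
      ((μ i).restrict {ω | X (n + 1) ω = y}).real {ω | Q fun t => X t ω} := by
    rw [measureReal_restrict_apply' hsucc]
    rfl
  rw [hset, hpath]
  refine sum_congr rfl fun w _ => ?_
  rw [measureReal_restrict_apply' hsucc]
  -- The one-step property in `IsMarkovChain`, for the path `w` followed by a step to `y`.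
  have h := hX.markov i n (fun t => if t ≤ n then extendPath n w t else y)
  have h1 : {ω | ∀ t ≤ n + 1, X t ω = if t ≤ n then extendPath n w t else y} =
      {ω | ∀ t ≤ n, X t ω = extendPath n w t} ∩ {ω | X (n + 1) ω = y} := by
    ext ω
    simp only [Set.mem_ofPred_eq, Set.mem_inter_iff]
    constructor
    · exact fun h => ⟨fun t ht => by simpa [ht] using h t (by omega),
        by simpa using h (n + 1) le_rfl⟩
    · rintro ⟨h1, h2⟩ t ht
      split_ifs with htn
      · exact h1 t htn
      · obtain rfl : t = n + 1 := by omega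
        exact h2
  have h2 : {ω | ∀ t ≤ n, X t ω = if t ≤ n then extendPath n w t else y} =
      {ω | ∀ t ≤ n, X t ω = extendPath n w t} := by
    ext ω
    exact forall₂_congr fun t ht => by rw [if_pos ht]
  rw [h1, h2] at h
  simpa using h

variable [DecidableEq S]

theorem numVisits_and_succ (hX : IsMarkovChain P X μ) (A : Finset S) (i : S) (c n : ℕ) (y : S) :
    (μ i).real {ω | numVisits X A n ω = c ∧ X (n + 1) ω = y} =
      ∑ x, visitLaw X μ A i c n x * P x y := by
  refine real_pathEvent_and_succ hX i n
    (fun u => ((Icc 1 n).filter fun t => u t ∈ A).card = c) (fun u v h hu => ?_) y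
  rw [← hu]
  congr 1
  exact filter_congr fun t ht => by rw [h t (mem_Icc.1 ht).2]

theorem visitLaw_succ_of_notMem (hX : IsMarkovChain P X μ) (A : Finset S) (i : S) (c n : ℕ)
    {y : S} (hy : y ∉ A) :
    visitLaw X μ A i c (n + 1) y = ∑ x, visitLaw X μ A i c n x * P x y := by
  rw [← numVisits_and_succ hX, visitLaw]
  congr 1
  ext ω
  refine and_congr_left fun h => ?_
  rw [numVisits_succ, h, if_neg hy, add_zero]

theorem visitLaw_succ_succ_of_mem (hX : IsMarkovChain P X μ) (A : Finset S) (i : S) (c n : ℕ)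
    {y : S} (hy : y ∈ A) :
    visitLaw X μ A i (c + 1) (n + 1) y = ∑ x, visitLaw X μ A i c n x * P x y := by
  rw [← numVisits_and_succ hX, visitLaw]
  congr 1
  ext ω
  refine and_congr_left fun h => ?_
  rw [numVisits_succ, h, if_pos hy, add_left_inj]

theorem visitLaw_zero_off (hX : IsMarkovChain P X μ) {A B : Finset S} (hB : B = Aᶜ) (c : ℕ) :
    (Matrix.of fun (i : A) (y : B) => visitLaw X μ A i c 0 y) = 0 := by
  have hBA : ∀ y ∈ B, y ∉ A := by subst hB; simp
  ext i y
  have hy : (i : S) ≠ y := fun h => hBA y y.2 (h ▸ i.2)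
  simp [visitLaw_zero hX, hy]

/-- The law outside `A`, split by the pair `x`: the last time in `A` is `x.1`, after which the chain
steps into `B` and makes `x.2` further steps there. -/
theorem visitLaw_succ_eq_sum_antidiagonal (hX : IsMarkovChain P X μ) {A B : Finset S}
    (hB : B = Aᶜ) (c n : ℕ) :
    (Matrix.of fun (i : A) (y : B) => visitLaw X μ A i c (n + 1) y) =
      ∑ x ∈ antidiagonal n, (Matrix.of fun i j : A => visitLaw X μ A i c x.1 j) *
        (block P A B * block P B B ^ x.2) := by
  have hBA : ∀ y ∈ B, y ∉ A := by subst hB; simp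
  have hstep : ∀ n, (Matrix.of fun (i : A) (y : B) => visitLaw X μ A i c (n + 1) y) =
      (Matrix.of fun i j : A => visitLaw X μ A i c n j) * block P A B +
        (Matrix.of fun (i : A) (y : B) => visitLaw X μ A i c n y) * block P B B := by
    intro n
    ext i y
    simp only [Matrix.of_apply, Matrix.add_apply, Matrix.mul_apply]
    rw [visitLaw_succ_of_notMem hX A i c n (hBA y y.2), sum_eq_sum_coe_add_sum_coe hB]
    rfl
  induction n with
  | zero =>
    rw [hstep, visitLaw_zero_off hX hB]
    simp
  | succ n ih =>
    rw [hstep, ih, Nat.sum_antidiagonal_succ', Matrix.sum_mul, pow_zero, Matrix.mul_one]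
    congr 1
    refine sum_congr rfl fun x _ => ?_
    rw [pow_succ, Matrix.mul_assoc, Matrix.mul_assoc]

/-- The generating function of the first recurrence time of `A`: a return takes one step inside `A`,
or `s + 2` steps along an excursion to the complement. -/
noncomputable def recurrenceSeries (P : Matrix S S ℝ) (A B : Finset S) :
    PowerSeries (Matrix A A ℝ) :=
  C (block P A A) * PowerSeries.X +
    PowerSeries.X ^ 2 * PowerSeries.mk fun s => block P A B * block P B B ^ s * block P B A

/-- A further visit multiplies the generating function of the joint law by that of the first
recurrence time: the last step into `A` comes from `A`, or from an excursion that started at the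
previous visit. -/
theorem visitLaw_eq_coeff_recurrenceSeries_pow (hX : IsMarkovChain P X μ) {A B : Finset S}
    (hB : B = Aᶜ) (c n : ℕ) :
    (Matrix.of fun i j : A => visitLaw X μ A i c n j) =
      coeff n (recurrenceSeries P A B ^ c) := by
  induction c generalizing n with
  | zero =>
    rw [pow_zero, coeff_one]
    ext i j
    cases n with
    | zero =>
      rw [if_pos rfl, Matrix.one_apply, Matrix.of_apply, visitLaw_zero hX]
      simp only [Subtype.ext_iff, true_and]
    | succ n => simp [visitLaw_zero_succ_of_mem A i n j.2]
  | succ c ih =>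
    have hF : recurrenceSeries P A B ^ (c + 1) =
        (recurrenceSeries P A B ^ c * C (block P A A) + recurrenceSeries P A B ^ c *
          (PowerSeries.mk fun s => block P A B * block P B B ^ s * block P B A) *
            PowerSeries.X) * PowerSeries.X := by
      have hrec : recurrenceSeries P A B = C (block P A A) * PowerSeries.X +
          (PowerSeries.mk fun s => block P A B * block P B B ^ s * block P B A) *
            (PowerSeries.X * PowerSeries.X) := by
        rw [recurrenceSeries, X_pow_mul, sq]
      rw [pow_succ]
      nth_rewrite 2 [hrec]
      noncomm_ring
    rw [hF]
    cases n with
    | zero =>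
      ext i j
      simp [visitLaw_zero hX]
    | succ n =>
      have hstep : (Matrix.of fun i j : A => visitLaw X μ A i (c + 1) (n + 1) j) =
          (Matrix.of fun i j : A => visitLaw X μ A i c n j) * block P A A +
            (Matrix.of fun (i : A) (y : B) => visitLaw X μ A i c n y) * block P B A := by
        ext i j
        simp only [Matrix.of_apply, Matrix.add_apply, Matrix.mul_apply]
        rw [visitLaw_succ_succ_of_mem hX A i c n j.2, sum_eq_sum_coe_add_sum_coe hB]
        rfl
      rw [hstep, coeff_succ_mul_X, map_add, coeff_mul_C, ih]
      congr 1
      cases n with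
      | zero =>
        rw [visitLaw_zero_off hX hB, coeff_zero_mul_X, Matrix.zero_mul]
      | succ n =>
        rw [coeff_succ_mul_X, coeff_mul, visitLaw_succ_eq_sum_antidiagonal hX hB, Matrix.sum_mul]
        refine sum_congr rfl fun x _ => ?_
        rw [ih, coeff_mk]
        simp only [Matrix.mul_assoc]

/-- The `k`-th recurrence time of `A` is the sum of `k` successive first recurrence times: its matrix
generating function is the `k`-th power of that of the first one. -/
theorem recurrenceProb_eq_coeff (hX : IsMarkovChain P X μ) {A B : Finset S} (hB : B = Aᶜ)
    (k n : ℕ) :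
    recurrenceProb X μ A k n = coeff n (recurrenceSeries P A B ^ k) := by
  rw [← visitLaw_eq_coeff_recurrenceSeries_pow hX hB]
  ext i j
  rw [recurrenceProb_apply, Matrix.of_apply]

end Markov

/-! ### Moments of the recurrence times -/

section Moments

open Finset PowerSeries

theorem sum_range_succ_eq_add_sum_Icc {E : Type*} [AddCommMonoid E] (f : ℕ → E) (k : ℕ) :
    ∑ r ∈ range (k + 1), f r = f 0 + ∑ r ∈ Icc 1 k, f r := by
  rw [range_eq_Ico, sum_eq_sum_Ico_succ_bot (Nat.succ_pos k)]
  rfl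

/-- The moments of the coefficients of `(zA + z² B (1 - zD)⁻¹ C)^k`, when `A` commutes with the
coefficients of the second summand and `C B` with `D`. -/
theorem hasSum_pow_smul_coeff_pow {m n : Type*} [Fintype m] [Fintype n] [DecidableEq m]
    [DecidableEq n] (A : Matrix m m ℝ) (B : Matrix m n ℝ) (D E : Matrix n n ℝ) (Cm : Matrix n m ℝ)
    (hA : ∀ s, Commute A (B * D ^ s * Cm)) (hD : Commute (Cm * B) D)
    (hE : HasSum (fun s => D ^ s) E) (q k : ℕ) :
    HasSum (fun l : ℕ => (l : ℝ) ^ q • coeff l ((C A * PowerSeries.X +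
        PowerSeries.X ^ 2 * PowerSeries.mk fun s => B * D ^ s * Cm) ^ k))
      ((k : ℝ) ^ q • A ^ k + ∑ r ∈ Icc 1 k, (k.choose r : ℝ) •
        (A ^ (k - r) * B * (Cm * B) ^ (r - 1) *
          (∑ j ∈ range (q + 1), (((j + r - 1).choose j : ℝ) * msn q j ((k : ℝ) + r)) •
            (D ^ j * E ^ (j + r))) * Cm)) := by
  -- The moments of the `r`-th power of the second summand, without the factor `A ^ (k - r)`.
  let T : ℕ → Matrix m m ℝ := fun r => if r = 0 then (k : ℝ) ^ q • 1 else
    B * (Cm * B) ^ (r - 1) *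
      (∑ j ∈ range (q + 1), (((j + r - 1).choose j : ℝ) * msn q j ((k : ℝ) + r)) •
        (D ^ j * E ^ (j + r))) * Cm
  have hT : ∀ r ≤ k, HasSum (fun s : ℕ => ((s : ℝ) + (k + r)) ^ q •
      coeff s ((PowerSeries.mk fun s => B * D ^ s * Cm) ^ r)) (T r) := by
    rintro (_ | r) -
    · simpa [T] using hasSum_add_pow_smul_coeff_one (R := Matrix m m ℝ) q (k : ℝ)
    · have h := Matrix.hasSum_add_pow_mul_choose_smul_pow hE q r ((k : ℝ) + (r + 1 : ℕ))
      have hcont : Continuous fun N : Matrix n n ℝ => B * (Cm * B) ^ r * N * Cm := by fun_prop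
      let φ : Matrix n n ℝ →+ Matrix m m ℝ :=
        AddMonoidHom.mk' (fun N => B * (Cm * B) ^ r * N * Cm) fun N N' => by
          rw [Matrix.mul_add, Matrix.add_mul]
      have h' := h.map φ hcont
      simp only [T, Nat.add_one_ne_zero, if_false, Nat.add_sub_cancel, ← add_assoc] at h' ⊢
      refine h'.congr_fun fun s => ?_
      rw [mk_mul_pow_mul_pow B D Cm hD, coeff_mk]
      simp [φ, smul_smul]
  have h := hasSum_pow_smul_coeff_linear_add_sq_mul_pow A _ hA q k T hT
  rw [sum_range_succ_eq_add_sum_Icc] at h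
  have h0 : (k.choose 0 : ℝ) • (A ^ (k - 0) * T 0) = (k : ℝ) ^ q • A ^ k := by simp [T]
  have hsum : ∀ r ∈ Icc 1 k, (k.choose r : ℝ) • (A ^ (k - r) * T r) = (k.choose r : ℝ) •
      (A ^ (k - r) * B * (Cm * B) ^ (r - 1) *
        (∑ j ∈ range (q + 1), (((j + r - 1).choose j : ℝ) * msn q j ((k : ℝ) + r)) •
          (D ^ j * E ^ (j + r))) * Cm) := fun r hr => by
    have hr0 : r ≠ 0 := by have := (mem_Icc.1 hr).1; omega
    simp only [T, if_neg hr0, Matrix.mul_assoc]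
  rw [h0, sum_congr rfl hsum] at h
  exact h

theorem HasSum.hasRecurrenceMoment_and_eq {S Ω : Type*} [DecidableEq S] [MeasurableSpace Ω]
    {X : ℕ → Ω → S} {μ : S → MeasureTheory.Measure Ω} {A : Finset S} {m k : ℕ} {L : Matrix A A ℝ}
    (h : HasSum (fun n : ℕ => (n : ℝ) ^ m • recurrenceProb X μ A k n) L) :
    HasRecurrenceMoment X μ A m k ∧ recurrenceMoment X μ A m k = L :=
  ⟨h.summable, h.tsum_eq⟩

variable {S : Type*} [Fintype S] [DecidableEq S] {P : Matrix S S ℝ}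

theorem block_mulVec_one_add (hP : P ∈ Matrix.rowStochastic ℝ S) {A B : Finset S} (hB : B = Aᶜ)
    (F : Finset S) : (block P F A).mulVec 1 + (block P F B).mulVec 1 = 1 := by
  ext i
  simp only [Pi.add_apply, Matrix.mulVec, dotProduct, Pi.one_apply, mul_one]
  rw [← Matrix.sum_row_of_mem_rowStochastic hP i, sum_eq_sum_coe_add_sum_coe hB]
  rfl

theorem pow_mulVec_one_of_mulVec_one {n : Type*} [Fintype n] [DecidableEq n] {D : Matrix n n ℝ}
    {s : ℝ} (h : D.mulVec 1 = s • 1) (l : ℕ) : (D ^ l).mulVec 1 = s ^ l • 1 := by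
  induction l with
  | zero => simp
  | succ l ih =>
    rw [pow_succ, ← Matrix.mulVec_mulVec, h, Matrix.mulVec_smul, ih, smul_smul, pow_succ']

/-- A row sum `s` of a matrix with convergent Neumann series satisfies `|s| < 1`, as `sˡ` is the row
sum of the `l`-th power. -/
theorem abs_lt_one_of_mulVec_one {n : Type*} [Fintype n] [DecidableEq n] [Nonempty n]
    {D E : Matrix n n ℝ} {s : ℝ} (h : D.mulVec 1 = s • 1) (hE : HasSum (fun l => D ^ l) E) :
    |s| < 1 := by
  obtain ⟨i⟩ := ‹Nonempty n›
  have h1 : Summable fun l => s ^ l := by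
    have h2 : Summable fun l => ∑ j, (D ^ l) i j :=
      summable_sum fun j _ => Pi.summable.1 (Pi.summable.1 hE.summable i) j
    refine h2.congr fun l => ?_
    have := congrFun (pow_mulVec_one_of_mulVec_one h l) i
    simpa [Matrix.mulVec, dotProduct] using this
  simpa using summable_geometric_iff_norm_lt_one.1 h1

/-- On one-point blocks, a matrix is the scalar given by its row sum. -/
theorem eq_smul_one_of_mulVec_one {n : Type*} [Fintype n] [DecidableEq n] [Unique n]
    {N : Matrix n n ℝ} {c : ℝ} (h : N.mulVec 1 = c • 1) : N = c • 1 := by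
  ext i j
  have := congrFun h i
  rw [Subsingleton.elim j i]
  simpa [Matrix.mulVec, dotProduct, Subsingleton.elim i default] using this

/-- The moment formula with scalar blocks `a`, `1 - a`, `s`, `1 - s`. Its separate first term is the
summand `r = 0`, where `(j + 0 - 1).choose j` is `1` for `j = 0`, by the truncated subtraction, and
`0` otherwise. -/
theorem scalar_moment_eq (a s : ℝ) (hs : s ≠ 1) (m k : ℕ) :
    (k : ℝ) ^ m * a ^ k + ∑ r ∈ Icc 1 k, (k.choose r : ℝ) *
        (a ^ (k - r) * (1 - a) * ((1 - s) * (1 - a)) ^ (r - 1) *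
          (∑ j ∈ range (m + 1), (((j + r - 1).choose j : ℝ) * msn m j ((k : ℝ) + r)) *
            (s ^ j * (1 - s)⁻¹ ^ (j + r))) * (1 - s)) =
      ∑ r ∈ range (k + 1), (k.choose r : ℝ) * ((1 - a) ^ r * a ^ (k - r)) *
        ∑ j ∈ range (m + 1),
          ((j + r - 1).choose j : ℝ) * msn m j ((k : ℝ) + r) * (s / (1 - s)) ^ j := by
  have hs' : 1 - s ≠ 0 := sub_ne_zero.2 hs.symm
  rw [sum_range_succ_eq_add_sum_Icc _ k]
  congr 1
  · rw [sum_range_succ', sum_eq_zero]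
    · simp [msn]
      ring
    · intro j _
      rw [Nat.choose_eq_zero_of_lt (by omega)]
      simp
  · refine sum_congr rfl fun r hr => ?_
    obtain ⟨r, rfl⟩ : ∃ r', r = r' + 1 := ⟨r - 1, by have := (mem_Icc.1 hr).1; omega⟩
    simp only [mul_sum, sum_mul]
    refine sum_congr rfl fun j _ => ?_
    rw [Nat.add_sub_cancel, div_pow, mul_pow, inv_pow, ← add_assoc j r 1]
    field_simp
    ring

variable {Ω : Type*} [MeasurableSpace Ω] {X : ℕ → Ω → S} {μ : S → MeasureTheory.Measure Ω}

/-- Moments of the recurrence times of a one-point set `A`, when the complement `B` is left with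
the same probability `1 - s` from each of its states. Then `P_{AB} P_B^l P_{BA}` is the scalar
`(1 - a) s^l (1 - s)`, so that no commutation is needed. -/
theorem hasSum_recurrenceProb_of_card_eq_one (hP : P ∈ Matrix.rowStochastic ℝ S)
    (hX : IsMarkovChain P X μ) {A B : Finset S} (hB : B = Aᶜ) (hBne : B.Nonempty)
    (hA : A.card = 1) {a s : ℝ} (ha : block P A A = Matrix.of fun _ _ => a)
    (hunit : IsUnit (1 - block P B B)) (hs : (block P B B).mulVec 1 = s • 1) (m k : ℕ) :
    HasSum (fun n : ℕ => (n : ℝ) ^ m • recurrenceProb X μ A k n)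
      (Matrix.of fun _ _ => ∑ r ∈ range (k + 1),
        (k.choose r : ℝ) * ((1 - a) ^ r * a ^ (k - r)) * ∑ j ∈ range (m + 1),
          ((j + r - 1).choose j : ℝ) * msn m j ((k : ℝ) + r) * (s / (1 - s)) ^ j) := by
  have := hBne.to_subtype
  have : Unique A := by
    have : Fintype.card A = 1 := by simpa using hA
    exact (Fintype.card_eq_one_iff_nonempty_unique.1 this).some
  have habs := abs_lt_one_of_mulVec_one hs (hasSum_block_pow hP B hunit)
  have hs1 : s ≠ 1 := by rintro rfl; simp at habs
  have ha1 : (block P A A).mulVec 1 = a • 1 := by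
    ext i; simp [ha, Matrix.mulVec, dotProduct]
  have hB1 : (block P A B).mulVec 1 = (1 - a) • 1 := by
    rw [sub_smul, one_smul, ← ha1]
    exact eq_sub_of_add_eq' (block_mulVec_one_add hP hB A)
  have hC1 : (block P B A).mulVec 1 = (1 - s) • 1 := by
    rw [sub_smul, one_smul, ← hs]
    exact eq_sub_of_add_eq (block_mulVec_one_add hP hB B)
  -- The general formula is applied to these scalar blocks, for which all commutations are trivial.
  have hw : ∀ l, block P A B * block P B B ^ l * block P B A =
      ((1 - a) • 1 : Matrix A A ℝ) * (s • 1 : Matrix A A ℝ) ^ l * ((1 - s) • 1 : Matrix A A ℝ) := by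
    intro l
    have : block P A B * block P B B ^ l * block P B A = ((1 - a) * s ^ l * (1 - s)) • 1 := by
      refine eq_smul_one_of_mulVec_one ?_
      rw [← Matrix.mulVec_mulVec, ← Matrix.mulVec_mulVec, hC1, Matrix.mulVec_smul,
        pow_mulVec_one_of_mulVec_one hs, smul_smul, Matrix.mulVec_smul, hB1, smul_smul]
      congr 1
      ring
    rw [this, smul_pow, one_pow]
    simp only [smul_mul_smul_comm, mul_one]
  have hE : HasSum (fun l => (s • 1 : Matrix A A ℝ) ^ l) ((1 - s)⁻¹ • 1) := by
    simp only [smul_pow, one_pow]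
    exact (hasSum_geometric_of_abs_lt_one habs).smul_const 1
  have hcomm : ∀ (c : ℝ) (N : Matrix A A ℝ), Commute (c • 1) N :=
    fun c N => (Commute.one_left N).smul_left c
  have h := hasSum_pow_smul_coeff_pow (a • 1 : Matrix A A ℝ) ((1 - a) • 1) (s • 1)
    ((1 - s)⁻¹ • 1) ((1 - s) • 1) (fun _ => hcomm _ _) (hcomm _ _).symm hE m k
  simp only [recurrenceProb_eq_coeff hX hB, recurrenceSeries, hw,
    eq_smul_one_of_mulVec_one ha1]
  convert h using 1
  rw [← scalar_moment_eq a s hs1]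
  simp only [← Algebra.algebraMap_eq_smul_one]
  simp only [Algebra.smul_def, ← map_pow, ← map_mul, ← map_sum, ← map_add]
  ext i j
  rw [Subsingleton.elim j i, Matrix.of_apply, Matrix.algebraMap_matrix_apply, if_pos rfl]
  rfl

end Moments

theorem mainTheorem2 {S Ω : Type*} [Fintype S] [DecidableEq S] [MeasurableSpace Ω]
    (P : Matrix S S ℝ) (hP : P ∈ Matrix.rowStochastic ℝ S)
    (M : Finset S) (hM : M.Nonempty) (hMc : (Mᶜ).Nonempty)
    (X : ℕ → Ω → S) (μ : S → MeasureTheory.Measure Ω) (hX : IsMarkovChain P X μ)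
    (m k : ℕ) (hk : 1 ≤ k) :
    -- a)
    (IsUnit (1 - block P Mᶜ Mᶜ) → IsCommutable P M Mᶜ → IsCommutable P Mᶜ M →
      HasRecurrenceMoment X μ M m k ∧
      recurrenceMoment X μ M m k =
        (k : ℝ) ^ m • block P M M ^ k +
          ∑ r ∈ Finset.Icc 1 k, (k.choose r : ℝ) •
            (block P M M ^ (k - r) * block P M Mᶜ * (block P Mᶜ M * block P M Mᶜ) ^ (r - 1) *
              (∑ j ∈ Finset.range (m + 1),
                (((j + r - 1).choose j : ℝ) * msn m j ((k : ℝ) + r)) •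
                  (block P Mᶜ Mᶜ ^ j * ((1 - block P Mᶜ Mᶜ)⁻¹) ^ (j + r))) *
              block P Mᶜ M)) ∧
    -- b)
    (∀ p s : ℝ, M.card = 1 → (block P M M = Matrix.of fun _ _ => 1 - p) → p ≠ 1 →
      IsUnit (1 - block P Mᶜ Mᶜ) → (block P Mᶜ Mᶜ).mulVec 1 = s • 1 →
      HasRecurrenceMoment X μ M m k ∧
      recurrenceMoment X μ M m k = Matrix.of fun _ _ =>
        ∑ r ∈ Finset.range (k + 1), (k.choose r : ℝ) * (p / (1 - p)) ^ r * (1 - p) ^ k *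
          ∑ j ∈ Finset.range (m + 1),
            ((j + r - 1).choose j : ℝ) * msn m j ((k : ℝ) + r) * (s / (1 - s)) ^ j) ∧
    -- c)
    (∀ s : ℝ, (Mᶜ).card = 1 → block P Mᶜ Mᶜ = 0 →
      IsUnit (1 - block P M M) → (block P M M).mulVec 1 = s • 1 →
      HasRecurrenceMoment X μ Mᶜ m k ∧
      recurrenceMoment X μ Mᶜ m k = Matrix.of fun _ _ =>
        ∑ j ∈ Finset.range (m + 1),
          ((j + k - 1).choose j : ℝ) * msn m j (2 * k) * (s / (1 - s)) ^ j) := by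
  refine ⟨fun hunit hc hc' => HasSum.hasRecurrenceMoment_and_eq ?_,
    fun p s hcard hp hp1 hunit hs => ?_, fun s hcard h0 hunit hs => ?_⟩
  · simp only [recurrenceProb_eq_coeff hX rfl, recurrenceSeries]
    refine hasSum_pow_smul_coeff_pow _ _ _ _ _ (fun s => ?_) ?_ (hasSum_block_pow hP _ hunit) m k
    · have h := hc 1 s
      rw [pow_one] at h
      exact h.symm
    · have h := hc' 1 0
      rwa [pow_one, pow_zero, Matrix.mul_one] at h
  · refine HasSum.hasRecurrenceMoment_and_eq ?_
    have h := hasSum_recurrenceProb_of_card_eq_one hP hX rfl hMc hcard hp hunit hs m k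
    convert h using 3
    ext
    refine Finset.sum_congr rfl fun r hr => ?_
    have hp' : 1 - p ≠ 0 := sub_ne_zero.2 hp1.symm
    have hr' : r ≤ k := by simpa [Nat.lt_succ_iff] using hr
    rw [sub_sub_cancel, div_pow, mul_assoc (k.choose r : ℝ), div_mul_eq_mul_div, mul_div_assoc,
      pow_sub₀ _ hp' hr', div_eq_mul_inv]
  · refine HasSum.hasRecurrenceMoment_and_eq ?_
    -- The roles of `M` and its complement are exchanged.
    have h := hasSum_recurrenceProb_of_card_eq_one hP hX (compl_compl M).symm hM hcard
      (a := 0) (by rw [h0]; rfl) hunit hs m k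
    convert h using 3
    ext
    symm
    -- Only the excursions contribute, since the chain never stays in the single state.
    rw [Finset.sum_eq_single k]
    · simp [two_mul]
    · intro r hr hrk
      have : k - r ≠ 0 := by have := Finset.mem_range.1 hr; omega
      simp [this]
    · simp
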